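/- Let $M$ be a nonempty smooth $3$-manifold with a Riemannian metric $g$, Levi-Civita connection $\nabla$, Ricci tensor $S$ and scalar curvature $r$; the curvature is $R(X,Y)Z=\nabla_X\nabla_YZ-\nabla_Y\nabla_XZ-\nabla_{[X,Y]}Z$ and $S(Y,Z)$ is the trace of $X\mapsto R(X,Y)Z$. Let $(\phi,\xi,\eta)$ be an almost contact metric structure on $(M,g)$, that is, a smooth $(1,1)$-tensor field $\phi$, a smooth vector field $\xi$ and a smooth $1$-form $\eta$ such that, for all vector fields $X,Y$, $$\phi^2X=-X+\eta(X)\xi,\quad \eta(\xi)=1,\quad \eta(X)=g(X,\xi),\quad g(\phi X,\phi Y)=g(X,Y)-\eta(X)\eta(Y),\quad g(X,\phi Y)+g(Y,\phi X)=0.$$ Assume that this structure is trans-Sasakian of type $(\alpha,\beta)$ with real constants $\alpha,\beta$, that is, for all vector fields $X,Y$, $$(\nabla_X\phi)Y=\alpha\,[g(X,Y)\xi-\eta(Y)X]+\beta\,[g(\phi X,Y)\xi-\eta(Y)\phi X].$$ Suppose that $(g,\xi,\lambda,\mu)$, with $\lambda,\mu\in\mathbb R$, is an $\eta$-Einstein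 soliton on $M$, that is, $$\mathcal L_\xi g+2S+(2\lambda-r)\,g+2\mu\,\eta\otimes\eta=0.$$ Then: 1. $M$ is $\eta$-Einstein: there are smooth functions $a,b$ on $M$ with $S=a\,g+b\,\eta\otimes\eta$; 2. the scalar curvature is constant, $r=6\lambda+4\beta+2\mu$; 3. $\lambda=(\alpha^2-\beta^2)-\beta$; 4. the soliton is shrinking ($\lambda<0$), steady ($\lambda=0$) or expanding ($\lambda>0$) if and only if $\alpha^2<\beta(\beta+1)$, $\alpha^2=\beta(\beta+1)$ or $\alpha^2>\beta(\beta+1)$, respectively. -/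

import Mathlib

open Bundle VectorField FiberBundle
open scoped Manifold ContDiff

set_option linter.unusedSectionVars false

noncomputable section

namespace TransSasakian

variable {E : Type*} [NormedAddCommGroup E] [NormedSpace ℝ E] [FiniteDimensional ℝ E]
  {H : Type*} [TopologicalSpace H] {I : ModelWithCorners ℝ E H}
  {M : Type*} [TopologicalSpace M] [ChartedSpace H M] [IsManifold I ∞ M]
  [RiemannianBundle (fun x : M ↦ TangentSpace I x)]
  [IsContMDiffRiemannianBundle I ∞ E (fun x : M ↦ TangentSpace I x)]

/-- The right-hand side of the Koszul formula for `2 g(∇_X Y, Z)`. -/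
def koszul (Y X Z : Π x : M, TangentSpace I x) (x : M) : ℝ :=
  d% (fun y ↦ inner ℝ (Y y) (Z y)) x (X x) + d% (fun y ↦ inner ℝ (Z y) (X y)) x (Y x)
    - d% (fun y ↦ inner ℝ (X y) (Y y)) x (Z x)
    - inner ℝ (X x) (mlieBracket I Y Z x) + inner ℝ (Y x) (mlieBracket I Z X x)
    + inner ℝ (Z x) (mlieBracket I X Y x)

theorem mdifferentiableAt_inner {Y Z : Π x : M, TangentSpace I x} {x : M}
    (hY : MDiffAt (T% Y) x) (hZ : MDiffAt (T% Z) x) :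
    MDiffAt (fun y ↦ inner ℝ (Y y) (Z y)) x :=
  MDifferentiableAt.inner_bundle (E := fun x : M ↦ TangentSpace I x) hY hZ

theorem tensorial_koszul₁ {Y Z : Π x : M, TangentSpace I x} {x : M}
    (hY : MDiffAt (T% Y) x) (hZ : MDiffAt (T% Z) x) :
    TensorialAt I E (koszul Y · Z x) x where
  smul {f X} hf hX := by
    have : CompleteSpace E := FiniteDimensional.complete ℝ E
    have h1 := mdifferentiableAt_inner hZ hX
    have h2 := mdifferentiableAt_inner hX hY
    simp [koszul, mlieBracket_smul_left hf hX, mlieBracket_smul_right hf hX, inner_smul_left,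
      inner_smul_right, inner_add_right, mvfderiv_fun_mul hf h1, mvfderiv_fun_mul hf h2,
      real_inner_comm (X x) (Y x)]
    ring
  add {X X'} hX hX' := by
    have : CompleteSpace E := FiniteDimensional.complete ℝ E
    have h1 := mdifferentiableAt_inner hZ hX
    have h2 := mdifferentiableAt_inner hX hY
    have h1' := mdifferentiableAt_inner hZ hX'
    have h2' := mdifferentiableAt_inner hX' hY
    simp [koszul, mlieBracket_add_left hX hX', mlieBracket_add_right hX hX', inner_add_left,
      inner_add_right, mvfderiv_fun_add h1 h1', mvfderiv_fun_add h2 h2']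
    ring

theorem tensorial_koszul₂ {Y X : Π x : M, TangentSpace I x} {x : M}
    (hY : MDiffAt (T% Y) x) (hX : MDiffAt (T% X) x) :
    TensorialAt I E (koszul Y X · x) x where
  smul {f Z} hf hZ := by
    have : CompleteSpace E := FiniteDimensional.complete ℝ E
    have h1 := mdifferentiableAt_inner hZ hX
    have h2 := mdifferentiableAt_inner hY hZ
    simp [koszul, mlieBracket_smul_left hf hZ, mlieBracket_smul_right hf hZ, inner_smul_left,
      inner_smul_right, inner_add_right, mvfderiv_fun_mul hf h1, mvfderiv_fun_mul hf h2,
      real_inner_comm (X x) (Z x)]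
    ring
  add {Z Z'} hZ hZ' := by
    have : CompleteSpace E := FiniteDimensional.complete ℝ E
    have h1 := mdifferentiableAt_inner hZ hX
    have h2 := mdifferentiableAt_inner hY hZ
    have h1' := mdifferentiableAt_inner hZ' hX
    have h2' := mdifferentiableAt_inner hY hZ'
    simp [koszul, mlieBracket_add_left hZ hZ', mlieBracket_add_right hZ hZ', inner_add_left,
      inner_add_right, mvfderiv_fun_add h1 h1', mvfderiv_fun_add h2 h2']
    ring

open scoped Classical in
/-- The bilinear form `(v, w) ↦ 2 g(∇_v Y, w)` on the tangent space at `x`, for a vector field `Y`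
that is differentiable at `x` (and `0` for other `Y`). -/
def koszulForm (Y : Π x : M, TangentSpace I x) (x : M) :
    TangentSpace I x →L[ℝ] TangentSpace I x →L[ℝ] ℝ :=
  if hY : MDiffAt (T% Y) x then
    TensorialAt.mkHom₂ (koszul Y · · x) x (fun _ hZ ↦ tensorial_koszul₁ hY hZ)
      (fun _ hX ↦ tensorial_koszul₂ hY hX)
  else 0

theorem koszulForm_apply {X Y Z : Π x : M, TangentSpace I x} {x : M}
    (hX : MDiffAt (T% X) x) (hY : MDiffAt (T% Y) x) (hZ : MDiffAt (T% Z) x) :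
    koszulForm Y x (X x) (Z x) = koszul Y X Z x := by
  rw [koszulForm, dif_pos hY]
  exact TensorialAt.mkHom₂_apply _ _ hX hZ

instance finiteDimensional_tangentSpace (x : M) : FiniteDimensional ℝ (TangentSpace I x) :=
  inferInstanceAs (FiniteDimensional ℝ E)

/-- `∇_v Y`: half the vector that represents the form `w ↦ 2 g(∇_v Y, w)`. -/
def lcFun (Y : Π x : M, TangentSpace I x) (x : M) : TangentSpace I x →L[ℝ] TangentSpace I x :=
  have : CompleteSpace (TangentSpace I x) := FiniteDimensional.complete ℝ _
  LinearMap.toContinuousLinearMap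
    { toFun v := (2 : ℝ)⁻¹ • (InnerProductSpace.toDual ℝ (TangentSpace I x)).symm (koszulForm Y x v)
      map_add' v w := by simp
      map_smul' c v := by simp [smul_comm c] }

theorem inner_lcFun (Y : Π x : M, TangentSpace I x) (x : M) (v w : TangentSpace I x) :
    inner ℝ (lcFun Y x v) w = 2⁻¹ * koszulForm Y x v w := by
  have : CompleteSpace (TangentSpace I x) := FiniteDimensional.complete ℝ _
  change inner ℝ ((2 : ℝ)⁻¹ • (InnerProductSpace.toDual ℝ (TangentSpace I x)).symm
    (koszulForm Y x v)) w = _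
  rw [real_inner_smul_left, InnerProductSpace.toDual_symm_apply]

theorem ext_inner_extend {x : M} {A B : TangentSpace I x →L[ℝ] TangentSpace I x}
    (h : ∀ X Z : Π x : M, TangentSpace I x, MDiffAt (T% X) x → MDiffAt (T% Z) x →
      inner ℝ (A (X x)) (Z x) = inner ℝ (B (X x)) (Z x)) : A = B := by
  ext v
  refine ext_inner_right ℝ fun w ↦ ?_
  simpa using h (extend E v) (extend E w) (mdifferentiableAt_extend ..)
    (mdifferentiableAt_extend ..)

variable (I M) in
/-- The Levi-Civita connection, defined by the Koszul formula. -/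
def leviCivita : CovariantDerivative I E (TangentSpace I : M → Type _) where
  toFun := lcFun
  isCovariantDerivativeOnUniv :=
    { add := by
        intro Y Y' x hY hY' _
        have : CompleteSpace E := FiniteDimensional.complete ℝ E
        refine ext_inner_extend fun X Z hX hZ ↦ ?_
        have hs := mdifferentiableAt_add_section hY hY'
        have h1 := mdifferentiableAt_inner hY hZ
        have h1' := mdifferentiableAt_inner hY' hZ
        have h2 := mdifferentiableAt_inner hX hY
        have h2' := mdifferentiableAt_inner hX hY'
        rw [inner_lcFun, koszulForm_apply hX hs hZ, add_apply, inner_add_left,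
          inner_lcFun, inner_lcFun, koszulForm_apply hX hY hZ, koszulForm_apply hX hY' hZ]
        simp [koszul, mlieBracket_add_left hY hY', mlieBracket_add_right hY hY', inner_add_left,
          inner_add_right, mvfderiv_fun_add h1 h1', mvfderiv_fun_add h2 h2']
        ring
      leibniz := by
        intro Y f x hY hf _
        have : CompleteSpace E := FiniteDimensional.complete ℝ E
        refine ext_inner_extend fun X Z hX hZ ↦ ?_
        have hs := hf.smul_section hY
        have h1 := mdifferentiableAt_inner hY hZ
        have h2 := mdifferentiableAt_inner hX hY
        rw [inner_lcFun, koszulForm_apply hX hs hZ, add_apply, inner_add_left,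
          smul_apply, real_inner_smul_left,
          inner_lcFun, koszulForm_apply hX hY hZ]
        simp [koszul, mlieBracket_smul_left hf hY, mlieBracket_smul_right hf hY, inner_smul_left,
          inner_smul_right, inner_add_right, mvfderiv_fun_mul hf h1, mvfderiv_fun_mul hf h2,
          real_inner_comm (Z x) (Y x)]
        ring }

/-- The Koszul formula, which characterizes the connection. -/
theorem two_mul_inner_leviCivita {X Y Z : Π x : M, TangentSpace I x} {x : M}
    (hX : MDiffAt (T% X) x) (hY : MDiffAt (T% Y) x) (hZ : MDiffAt (T% Z) x) :
    2 * inner ℝ (leviCivita I M Y x (X x)) (Z x) = koszul Y X Z x := by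
  change 2 * inner ℝ (lcFun Y x (X x)) (Z x) = _
  rw [inner_lcFun, koszulForm_apply hX hY hZ]
  ring

/-- The connection is torsion-free. -/
theorem leviCivita_torsionFree {X Y : Π x : M, TangentSpace I x} {x : M}
    (hX : MDiffAt (T% X) x) (hY : MDiffAt (T% Y) x) :
    leviCivita I M Y x (X x) - leviCivita I M X x (Y x) = mlieBracket I X Y x := by
  refine ext_inner_right ℝ fun w ↦ ?_
  have hZ : MDiffAt (T% (extend E w)) x := mdifferentiableAt_extend ..
  have h1 := two_mul_inner_leviCivita hX hY hZ
  have h2 := two_mul_inner_leviCivita hY hX hZ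
  have e1 : (fun y ↦ inner ℝ (X y) (Y y)) = fun y ↦ inner ℝ (Y y) (X y) :=
    funext fun y ↦ real_inner_comm _ _
  have e2 : (fun y ↦ inner ℝ (X y) (extend E w y)) = fun y ↦ inner ℝ (extend E w y) (X y) :=
    funext fun y ↦ real_inner_comm _ _
  have e3 : (fun y ↦ inner ℝ (Y y) (extend E w y)) = fun y ↦ inner ℝ (extend E w y) (Y y) :=
    funext fun y ↦ real_inner_comm _ _
  simp only [koszul, extend_apply_self] at h1 h2
  rw [mlieBracket_swap_apply (V := Y) (W := extend E w),
    mlieBracket_swap_apply (V := X) (W := Y), e1, e3] at h1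
  rw [mlieBracket_swap_apply (V := X) (W := extend E w), e2] at h2
  rw [inner_sub_left, mlieBracket_swap_apply]
  simp only [inner_neg_right, real_inner_comm w] at *
  linarith

/-- The connection is compatible with the metric. -/
theorem leviCivita_metric {X Y Z : Π x : M, TangentSpace I x} {x : M}
    (hX : MDiffAt (T% X) x) (hY : MDiffAt (T% Y) x) (hZ : MDiffAt (T% Z) x) :
    d% (fun y ↦ inner ℝ (Y y) (Z y)) x (X x) =
      inner ℝ (leviCivita I M Y x (X x)) (Z x) + inner ℝ (Y x) (leviCivita I M Z x (X x)) := by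
  have h1 := two_mul_inner_leviCivita hX hY hZ
  have h2 := two_mul_inner_leviCivita hX hZ hY
  have e1 : (fun y ↦ inner ℝ (X y) (Y y)) = fun y ↦ inner ℝ (Y y) (X y) :=
    funext fun y ↦ real_inner_comm _ _
  have e2 : (fun y ↦ inner ℝ (X y) (Z y)) = fun y ↦ inner ℝ (Z y) (X y) :=
    funext fun y ↦ real_inner_comm _ _
  have e3 : (fun y ↦ inner ℝ (Y y) (Z y)) = fun y ↦ inner ℝ (Z y) (Y y) :=
    funext fun y ↦ real_inner_comm _ _
  simp only [koszul] at h1 h2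
  rw [e1, e3, mlieBracket_swap_apply (V := Z) (W := X)] at h1
  rw [e2, mlieBracket_swap_apply (V := Z) (W := Y), mlieBracket_swap_apply (V := Y) (W := X)] at h2
  rw [e3, real_inner_comm (leviCivita I M Z x (X x))]
  simp only [inner_neg_right] at *
  linarith

/-- The curvature `R(X, Y)Z = ∇_X ∇_Y Z - ∇_Y ∇_X Z - ∇_[X, Y] Z` on vector fields. -/
def curvature (X Y Z : Π x : M, TangentSpace I x) (x : M) : TangentSpace I x :=
  leviCivita I M (fun y ↦ leviCivita I M Z y (Y y)) x (X x)
    - leviCivita I M (fun y ↦ leviCivita I M Z y (X y)) x (Y x)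
    - leviCivita I M Z x (mlieBracket I X Y x)

/-- The curvature tensor at `x`: the value at `x` of `R(X, Y)Z`, for vector fields `X`, `Y`, `Z`
that are smooth near `x` and extend `u`, `v`, `w`. -/
def curvatureAt (x : M) (u v w : TangentSpace I x) : TangentSpace I x :=
  curvature (extend E u) (extend E v) (extend E w) x

/-- The Ricci tensor `S(v, w)`, the trace of `u ↦ R(u, v)w`. -/
def ricci (x : M) (v w : TangentSpace I x) : ℝ :=
  let e := stdOrthonormalBasis ℝ (TangentSpace I x)
  ∑ i, inner ℝ (curvatureAt x (e i) v w) (e i)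

variable (I) in
/-- The scalar curvature `r`, the metric trace of the Ricci tensor. -/
def scalarCurvature (x : M) : ℝ :=
  let e := stdOrthonormalBasis ℝ (TangentSpace I x)
  ∑ i, ricci x (e i) (e i)

/-- The Lie derivative of the metric,
`(L_V g)(X, Y) = V(g(X, Y)) - g([V, X], Y) - g(X, [V, Y])`. -/
def lieDerivMetric (V X Y : Π x : M, TangentSpace I x) (x : M) : ℝ :=
  d% (fun y ↦ inner ℝ (X y) (Y y)) x (V x)
    - inner ℝ (mlieBracket I V X x) (Y x) - inner ℝ (X x) (mlieBracket I V Y x)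

variable (I M) in
/-- An almost contact metric structure `(φ, ξ, η)` on the Riemannian manifold `M`. -/
structure AlmostContactMetric where
  /-- the `(1,1)` tensor field -/
  φ : Π x : M, TangentSpace I x →L[ℝ] TangentSpace I x
  /-- the characteristic vector field -/
  ξ : Π x : M, TangentSpace I x
  /-- the `1`-form -/
  η : Π x : M, TangentSpace I x →L[ℝ] ℝ
  smooth_φ : ContMDiff I (I.prod 𝓘(ℝ, E →L[ℝ] E)) ∞ fun x ↦
    (⟨x, φ x⟩ : TotalSpace (E →L[ℝ] E) fun x : M ↦ TangentSpace I x →L[ℝ] TangentSpace I x)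
  smooth_ξ : ContMDiff I (I.prod 𝓘(ℝ, E)) ∞ fun x ↦
    (⟨x, ξ x⟩ : TotalSpace E (TangentSpace I : M → Type _))
  smooth_η : ContMDiff I (I.prod 𝓘(ℝ, E →L[ℝ] ℝ)) ∞ fun x ↦
    (⟨x, η x⟩ : TotalSpace (E →L[ℝ] ℝ) fun x : M ↦ TangentSpace I x →L[ℝ] ℝ)
  φ_φ : ∀ x (v : TangentSpace I x), φ x (φ x v) = -v + η x v • ξ x
  η_ξ : ∀ x, η x (ξ x) = 1
  η_eq : ∀ x (v : TangentSpace I x), η x v = inner ℝ v (ξ x)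
  inner_φ_φ : ∀ x (v w : TangentSpace I x),
    inner ℝ (φ x v) (φ x w) = inner ℝ v w - η x v * η x w
  inner_φ_add : ∀ x (v w : TangentSpace I x), inner ℝ v (φ x w) + inner ℝ w (φ x v) = 0

namespace AlmostContactMetric

/-- The structure is trans-Sasakian of type `(α, β)`: `α`, `β` are smooth and `(∇_X φ)Y`, that is
`∇_X (φ Y) - φ (∇_X Y)`, equals `α (g(X, Y) ξ - η(Y) X) + β (g(φ X, Y) ξ - η(Y) φ X)`. -/
structure IsTransSasakian (A : AlmostContactMetric I M) (α β : M → ℝ) : Prop where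
  smooth_α : ContMDiff I 𝓘(ℝ) ∞ α
  smooth_β : ContMDiff I 𝓘(ℝ) ∞ β
  cov_φ : ∀ (x : M) (X Y : Π x : M, TangentSpace I x),
    CMDiffAt ∞ (T% X) x → CMDiffAt ∞ (T% Y) x →
    leviCivita I M (fun y ↦ A.φ y (Y y)) x (X x) - A.φ x (leviCivita I M Y x (X x)) =
      α x • ((inner ℝ (X x) (Y x) : ℝ) • A.ξ x - A.η x (Y x) • X x)
        + β x • ((inner ℝ (A.φ x (X x)) (Y x) : ℝ) • A.ξ x - A.η x (Y x) • A.φ x (X x))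

/-- The Ricci tensor has the form `a g + b η ⊗ η` with smooth functions `a`, `b`. -/
def IsEtaEinstein (A : AlmostContactMetric I M) : Prop :=
  ∃ a b : M → ℝ, ContMDiff I 𝓘(ℝ) ∞ a ∧ ContMDiff I 𝓘(ℝ) ∞ b ∧
    ∀ (x : M) (v w : TangentSpace I x), ricci x v w = a x * inner ℝ v w + b x * (A.η x v * A.η x w)

/-- An `η`-Einstein soliton `(g, ξ, λ, μ)`:
`L_ξ g + 2 S + (2 λ - r) g + 2 μ η ⊗ η = 0`, with real constants `λ` and `μ`. -/
structure EtaEinsteinSoliton (A : AlmostContactMetric I M) where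
  /-- the constant `λ` -/
  lam : ℝ
  /-- the constant `μ` -/
  mu : ℝ
  eq_zero : ∀ (x : M) (X Y : Π x : M, TangentSpace I x),
    CMDiffAt ∞ (T% X) x → CMDiffAt ∞ (T% Y) x →
    lieDerivMetric A.ξ X Y x + 2 * ricci x (X x) (Y x)
      + (2 * lam - scalarCurvature I x) * inner ℝ (X x) (Y x)
      + 2 * mu * (A.η x (X x) * A.η x (Y x)) = 0

namespace EtaEinsteinSoliton

variable {A : AlmostContactMetric I M}

/-- shrinking: `λ < 0` -/
def IsShrinking (s : A.EtaEinsteinSoliton) : Prop := s.lam < 0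

/-- steady: `λ = 0` -/
def IsSteady (s : A.EtaEinsteinSoliton) : Prop := s.lam = 0

/-- expanding: `λ > 0` -/
def IsExpanding (s : A.EtaEinsteinSoliton) : Prop := 0 < s.lam

end EtaEinsteinSoliton

end AlmostContactMetric

end TransSasakian

end

/-! Applying φ to the trans-Sasakian identity with Y = ξ gives ∇_v ξ = -α φv + β (v - η(v) ξ). Since
φ is skew, L_ξ g = 2β (g - η⊗η), and the soliton equation reads S = (r/2 - λ - β) g + (β - μ) η⊗η
(`ricci_eq`). Its trace is a linear equation for r with coefficient 2 - dim M, nonzero in dimension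
3; so r is the stated constant and both coefficients of S are constant.

A second value of S(ξ, ξ) fixes λ. Differentiating ∇ξ again gives R(X, Y)ξ (`curvature_ξ`), hence
S(ξ, ξ) = 2(α² - β²), while the soliton equation gives 2λ + 2β.

As `ricci` is built from chosen local extensions, the field ξ may replace the extension of its value
only because R is tensorial in its third argument. This follows from skew-adjointness of R(X, Y),
which rests on [X, Y]f = XYf - YXf and on the smoothness of ∇_Y Z. -/

namespace TransSasakian

open Filter Topology

/-! ### Smooth functions, vector fields and brackets -/

section Calculus

variable {E : Type*} [NormedAddCommGroup E] [NormedSpace ℝ E] [FiniteDimensional ℝ E]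
  {H : Type*} [TopologicalSpace H] {I : ModelWithCorners ℝ E H}
  {M : Type*} [TopologicalSpace M] [ChartedSpace H M] [IsManifold I ∞ M]

theorem minSmoothness_le_infty {n : ℕ∞ω} [ENat.LEInfty n] : minSmoothness ℝ n ≤ ∞ := by
  rw [minSmoothness_of_isRCLikeNormedField]
  exact ENat.LEInfty.out

theorem eventually_mdifferentiableAt_of_contMDiffAt {f : M → ℝ} {x : M} (hf : CMDiffAt ∞ f x) :
    ∀ᶠ y in 𝓝 x, MDiffAt f y := by
  have : IsManifold I 1 M := .of_le (n := ∞) (by simp)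
  have h1 : CMDiffAt 1 f x := hf.of_le (by simp)
  filter_upwards [(contMDiffAt_iff_contMDiffAt_nhds (by simp)).1 h1] with y hy
  exact hy.mdifferentiableAt one_ne_zero

/-- `leviCivita` obeys the Koszul formula only where the fields are differentiable; identities that
get differentiated again must hold on a neighbourhood. -/
theorem eventually_mdifferentiableAt_section {Y : Π x : M, TangentSpace I x} {x : M}
    (hY : CMDiffAt ∞ (T% Y) x) : ∀ᶠ y in 𝓝 x, MDiffAt (T% Y) y := by
  have : IsManifold I 1 M := .of_le (n := ∞) (by simp)
  have h1 : CMDiffAt 1 (T% Y) x := hY.of_le (by simp)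
  filter_upwards [(contMDiffAt_iff_contMDiffAt_nhds (by simp)).1 h1] with y hy
  exact hy.mdifferentiableAt one_ne_zero

theorem mvfderiv_congr {f g : M → ℝ} {x : M} (h : f =ᶠ[𝓝 x] g) : d% f x = d% g x := by
  ext v
  change mfderiv I 𝓘(ℝ) f x v = mfderiv I 𝓘(ℝ) g x v
  rw [h.mfderiv_eq]
  rfl

theorem contMDiffAt_mlieBracket {X Y : Π x : M, TangentSpace I x} {x : M}
    (hX : CMDiffAt ∞ (T% X) x) (hY : CMDiffAt ∞ (T% Y) x) :
    CMDiffAt ∞ (T% (mlieBracket I X Y)) x := by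
  have : CompleteSpace E := FiniteDimensional.complete ℝ E
  have : IsManifold I (((⊤ : ℕ∞) : ℕ∞ω) + 1) M := inferInstanceAs (IsManifold I ∞ M)
  have : IsManifold I (minSmoothness ℝ 2) M := .of_le (n := ∞) minSmoothness_le_infty
  exact ContMDiffAt.mlieBracket_vectorField (m := ⊤) (n := ⊤) hX hY (by simp)

theorem contMDiffAt_det {ι : Type*} [Fintype ι] [DecidableEq ι] {A : M → Matrix ι ι ℝ} {x : M}
    (hA : ∀ i j, CMDiffAt ∞ (fun y ↦ A y i j) x) : CMDiffAt ∞ (fun y ↦ (A y).det) x := by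
  simp only [Matrix.det_apply, zsmul_eq_mul, Units.smul_def]
  refine ContMDiffAt.sum fun σ _ ↦ contMDiffAt_const.mul ?_
  exact ContMDiffAt.prod fun i _ ↦ hA _ _

end Calculus

/-! ### Smoothness tested by the metric; the bracket as a commutator -/

section Riemannian

variable {E : Type*} [NormedAddCommGroup E] [NormedSpace ℝ E] [FiniteDimensional ℝ E]
  {H : Type*} [TopologicalSpace H] {I : ModelWithCorners ℝ E H}
  {M : Type*} [TopologicalSpace M] [ChartedSpace H M] [IsManifold I ∞ M]
  [RiemannianBundle (fun x : M ↦ TangentSpace I x)]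
  [IsContMDiffRiemannianBundle I ∞ E (fun x : M ↦ TangentSpace I x)]

theorem contMDiffAt_inner {Y Z : Π x : M, TangentSpace I x} {x : M}
    (hY : CMDiffAt ∞ (T% Y) x) (hZ : CMDiffAt ∞ (T% Z) x) :
    CMDiffAt ∞ (fun y ↦ inner ℝ (Y y) (Z y)) x :=
  ContMDiffAt.inner_bundle (E := fun x : M ↦ TangentSpace I x) hY hZ

/-- A vector field is smooth at `x` if its inner products with smooth vector fields are. -/
theorem contMDiffAt_section_of_inner {V : Π x : M, TangentSpace I x} {x : M}
    (hV : ∀ W : Π x : M, TangentSpace I x, CMDiffAt ∞ (T% W) x →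
      CMDiffAt ∞ (fun y ↦ inner ℝ (V y) (W y)) x) : CMDiffAt ∞ (T% V) x := by
  classical
  let e := trivializationAt E (TangentSpace I : M → Type _) x
  let b := Module.finBasis ℝ E
  let F := e.localFrame b
  have hF : IsLocalFrameOn I E ∞ F e.baseSet := e.isLocalFrameOn_localFrame_baseSet I ∞ b
  have hx : x ∈ e.baseSet := FiberBundle.mem_baseSet_trivializationAt' x
  have hxn : e.baseSet ∈ 𝓝 x := e.open_baseSet.mem_nhds hx
  have hFx (i) : CMDiffAt ∞ (T% (F i)) x := hF.contMDiffAt e.open_baseSet hx i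
  have hdet (y) (hy : y ∈ e.baseSet) : (Matrix.gram ℝ fun i ↦ F i y).det ≠ 0 :=
    Matrix.det_gram_ne_zero_iff_linearIndependent.2 (hF.linearIndependent hy)
  have hsmooth : CMDiffAt ∞ (fun y ↦ (Matrix.gram ℝ fun i ↦ F i y).det) x :=
    contMDiffAt_det fun i j ↦ contMDiffAt_inner (hFx i) (hFx j)
  refine hF.contMDiffAt_of_coeff (fun i ↦ ?_) hxn
  -- Cramer's rule: the coefficients of V in the frame F solve the linear system whose matrix is the
  -- Gram matrix of F and whose right-hand side is g(V, F_j).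
  have key : CMDiffAt ∞ (fun y ↦ (Matrix.gram ℝ fun i ↦ F i y).det⁻¹ *
      ((Matrix.gram ℝ fun i ↦ F i y).updateCol i fun j ↦ inner ℝ (V y) (F j y)).det) x := by
    refine (hsmooth.inv₀ (hdet x hx)).mul (contMDiffAt_det fun j k ↦ ?_)
    by_cases hk : k = i
    · subst hk
      simpa using hV _ (hFx j)
    · simpa [Matrix.updateCol_ne hk] using contMDiffAt_inner (hFx j) (hFx k)
  refine key.congr_of_eventuallyEq ?_
  filter_upwards [hxn] with y hy
  have hb : (fun j ↦ inner ℝ (V y) (F j y)) =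
      (Matrix.gram ℝ fun i ↦ F i y).mulVec fun i ↦ hF.coeff i y (V y) := by
    ext j
    conv_lhs => rw [hF.coeff_sum_eq V hy, sum_inner]
    simp only [Matrix.mulVec, dotProduct, Matrix.gram_apply, real_inner_smul_left]
    exact Finset.sum_congr rfl fun i _ ↦ by rw [real_inner_comm, mul_comm]
  rw [← Matrix.cramer_apply, hb, Matrix.cramer_eq_adjugate_mulVec, Matrix.mulVec_mulVec,
    Matrix.adjugate_mul, Matrix.smul_mulVec, Matrix.one_mulVec, Pi.smul_apply, smul_eq_mul,
    inv_mul_cancel_left₀ (hdet y hy)]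
  rfl

/-- Since [Y, fZ] = (Yf) Z + f [Y, Z], pairing with a field Z that does not vanish at x expresses Yf
through brackets and inner products, which are smooth. -/
theorem contMDiffAt_mvfderiv_apply [Nontrivial E] {f : M → ℝ} {Y : Π x : M, TangentSpace I x}
    {x : M} (hf : CMDiffAt ∞ f x) (hY : CMDiffAt ∞ (T% Y) x) :
    CMDiffAt ∞ (fun y ↦ d% f y (Y y)) x := by
  have : CompleteSpace E := FiniteDimensional.complete ℝ E
  obtain ⟨w, hw⟩ := exists_ne (0 : E)
  let Z : Π x : M, TangentSpace I x := extend E (show TangentSpace I x from w)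
  have hZ : CMDiffAt ∞ (T% Z) x := contMDiffAt_extend I E _
  have hZx : Z x ≠ 0 := by
    rw [show Z x = w from extend_apply_self E (show TangentSpace I x from w)]
    exact hw
  have hfZ : CMDiffAt ∞ (T% (f • Z)) x := hf.smul_section hZ
  have hN := contMDiffAt_inner hZ hZ
  have hNx : inner ℝ (Z x) (Z x) ≠ 0 := by simpa using hZx
  have key : CMDiffAt ∞ (fun y ↦ (inner ℝ (mlieBracket I Y (f • Z) y) (Z y)
      - f y * inner ℝ (mlieBracket I Y Z y) (Z y)) * (inner ℝ (Z y) (Z y))⁻¹) x :=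
    ((contMDiffAt_inner (contMDiffAt_mlieBracket hY hfZ) hZ).sub
      (hf.mul (contMDiffAt_inner (contMDiffAt_mlieBracket hY hZ) hZ))).mul (hN.inv₀ hNx)
  refine key.congr_of_eventuallyEq ?_
  filter_upwards [eventually_mdifferentiableAt_of_contMDiffAt hf,
    eventually_mdifferentiableAt_section hZ, hN.continuousAt.eventually_ne hNx] with y h1 h2 h3
  rw [mlieBracket_smul_right h1 h2, inner_add_left, real_inner_smul_left, real_inner_smul_left]
  field_simp
  ring

/-- `X (Y f) - Y (X f) = [X, Y] f`. -/
theorem mvfderiv_mlieBracket [Nontrivial E] {f : M → ℝ} {X Y : Π x : M, TangentSpace I x}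
    {x : M} (hf : CMDiffAt ∞ f x) (hX : CMDiffAt ∞ (T% X) x) (hY : CMDiffAt ∞ (T% Y) x) :
    d% f x (mlieBracket I X Y x) =
      d% (fun y ↦ d% f y (Y y)) x (X x) - d% (fun y ↦ d% f y (X y)) x (Y x) := by
  have : CompleteSpace E := FiniteDimensional.complete ℝ E
  have : IsManifold I (minSmoothness ℝ 3) M := .of_le (n := ∞) minSmoothness_le_infty
  obtain ⟨w, hw⟩ := exists_ne (0 : E)
  let Z : Π x : M, TangentSpace I x := extend E (show TangentSpace I x from w)
  have hZ : CMDiffAt ∞ (T% Z) x := contMDiffAt_extend I E _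
  have hZx : Z x ≠ 0 := by
    rw [show Z x = w from extend_apply_self E (show TangentSpace I x from w)]
    exact hw
  have hfZ : CMDiffAt ∞ (T% (f • Z)) x := hf.smul_section hZ
  have h2 : minSmoothness ℝ 2 ≤ (∞ : ℕ∞ω) := minSmoothness_le_infty
  have expand {V : Π x : M, TangentSpace I x} (hV : CMDiffAt ∞ (T% V) x)
      {U : Π x : M, TangentSpace I x} (hU : CMDiffAt ∞ (T% U) x) :
      mlieBracket I U (mlieBracket I V (f • Z)) x =
        d% (fun y ↦ d% f y (V y)) x (U x) • Z x + d% f x (V x) • mlieBracket I U Z x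
        + (d% f x (U x) • mlieBracket I V Z x + f x • mlieBracket I U (mlieBracket I V Z) x) := by
    have hdf := (contMDiffAt_mvfderiv_apply hf hV).mdifferentiableAt (by simp)
    have hZ' := hZ.mdifferentiableAt (by simp)
    have hf' := hf.mdifferentiableAt (by simp)
    have hVZ := (contMDiffAt_mlieBracket hV hZ).mdifferentiableAt (by simp)
    have heq : mlieBracket I V (f • Z) =ᶠ[𝓝 x]
        (fun y ↦ d% f y (V y)) • Z + f • mlieBracket I V Z := by
      filter_upwards [eventually_mdifferentiableAt_of_contMDiffAt hf,
        eventually_mdifferentiableAt_section hZ] with y h1 h2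
      rw [mlieBracket_smul_right h1 h2]
      rfl
    have heq' := EventuallyEq.mlieBracket_vectorField_eq (I := I) (EventuallyEq.refl (𝓝 x) U) heq
    rw [heq',
      mlieBracket_add_right (hdf.smul_section hZ') (hf'.smul_section hVZ),
      mlieBracket_smul_right hdf hZ', mlieBracket_smul_right hf' hVZ]
  -- Compare the Jacobi identities for X, Y, fZ and for X, Y, Z: what remains is a multiple of Z,
  -- which is nonzero at x.
  have jac := leibniz_identity_mlieBracket_apply (hX.of_le h2) (hY.of_le h2) (hfZ.of_le h2)
  have jac' := leibniz_identity_mlieBracket_apply (hX.of_le h2) (hY.of_le h2) (hZ.of_le h2)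
  rw [expand hY hX, expand hX hY,
    mlieBracket_smul_right (hf.mdifferentiableAt (by simp)) (hZ.mdifferentiableAt (by simp)),
    jac', smul_add] at jac
  have : (d% f x (mlieBracket I X Y x) - (d% (fun y ↦ d% f y (Y y)) x (X x)
      - d% (fun y ↦ d% f y (X y)) x (Y x))) • Z x = 0 := by
    rw [sub_smul, sub_smul, sub_eq_zero]
    linear_combination (norm := module) (-1 : ℝ) • jac
  exact sub_eq_zero.1 ((smul_eq_zero.1 this).resolve_right hZx)

end Riemannian

/-! ### Second covariant derivatives and symmetries of the curvature -/

section LeviCivita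

variable {E : Type*} [NormedAddCommGroup E] [NormedSpace ℝ E] [FiniteDimensional ℝ E]
  [Nontrivial E]
  {H : Type*} [TopologicalSpace H] {I : ModelWithCorners ℝ E H}
  {M : Type*} [TopologicalSpace M] [ChartedSpace H M] [IsManifold I ∞ M]
  [RiemannianBundle (fun x : M ↦ TangentSpace I x)]
  [IsContMDiffRiemannianBundle I ∞ E (fun x : M ↦ TangentSpace I x)]

/-- By the Koszul formula, the inner products of ∇_Y Z with smooth fields are smooth. -/
theorem contMDiffAt_leviCivita {Y Z : Π x : M, TangentSpace I x} {x : M}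
    (hY : CMDiffAt ∞ (T% Y) x) (hZ : CMDiffAt ∞ (T% Z) x) :
    CMDiffAt ∞ (T% (fun y ↦ leviCivita I M Z y (Y y))) x := by
  refine contMDiffAt_section_of_inner fun W hW ↦ ?_
  have key : CMDiffAt ∞ (fun y ↦ 2⁻¹ * koszul Z Y W y) x :=
    contMDiffAt_const.mul ((((((contMDiffAt_mvfderiv_apply (contMDiffAt_inner hZ hW) hY).add
      (contMDiffAt_mvfderiv_apply (contMDiffAt_inner hW hY) hZ)).sub
      (contMDiffAt_mvfderiv_apply (contMDiffAt_inner hY hZ) hW)).sub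
      (contMDiffAt_inner hY (contMDiffAt_mlieBracket hZ hW))).add
      (contMDiffAt_inner hZ (contMDiffAt_mlieBracket hW hY))).add
      (contMDiffAt_inner hW (contMDiffAt_mlieBracket hY hZ)))
  refine key.congr_of_eventuallyEq ?_
  filter_upwards [eventually_mdifferentiableAt_section hY, eventually_mdifferentiableAt_section hZ,
    eventually_mdifferentiableAt_section hW] with y h1 h2 h3
  rw [← two_mul_inner_leviCivita h1 h2 h3, inv_mul_cancel_left₀ two_ne_zero]

/-- Metric compatibility used twice. The two middle terms are exchanged by swapping X and Y, so they
drop out of the commutator that yields the curvature. -/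
theorem mvfderiv_mvfderiv_inner {X Y Z U : Π x : M, TangentSpace I x} {x : M}
    (hX : CMDiffAt ∞ (T% X) x) (hY : CMDiffAt ∞ (T% Y) x)
    (hZ : CMDiffAt ∞ (T% Z) x) (hU : CMDiffAt ∞ (T% U) x) :
    d% (fun y ↦ d% (fun z ↦ inner ℝ (Z z) (U z)) y (Y y)) x (X x) =
      inner ℝ (leviCivita I M (fun y ↦ leviCivita I M Z y (Y y)) x (X x)) (U x)
      + inner ℝ (leviCivita I M Z x (Y x)) (leviCivita I M U x (X x))
      + inner ℝ (leviCivita I M Z x (X x)) (leviCivita I M U x (Y x))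
      + inner ℝ (Z x) (leviCivita I M (fun y ↦ leviCivita I M U y (Y y)) x (X x)) := by
  have hYZ := (contMDiffAt_leviCivita hY hZ).mdifferentiableAt (by simp)
  have hYU := (contMDiffAt_leviCivita hY hU).mdifferentiableAt (by simp)
  have hX' := hX.mdifferentiableAt (by simp)
  have hZ' := hZ.mdifferentiableAt (by simp)
  have hU' := hU.mdifferentiableAt (by simp)
  have heq : (fun y ↦ d% (fun z ↦ inner ℝ (Z z) (U z)) y (Y y)) =ᶠ[𝓝 x] fun y ↦
      inner ℝ (leviCivita I M Z y (Y y)) (U y) + inner ℝ (Z y) (leviCivita I M U y (Y y)) := by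
    filter_upwards [eventually_mdifferentiableAt_section hY,
      eventually_mdifferentiableAt_section hZ,
      eventually_mdifferentiableAt_section hU] with y h1 h2 h3
    exact leviCivita_metric h1 h2 h3
  have hd : d% (fun y ↦ d% (fun z ↦ inner ℝ (Z z) (U z)) y (Y y)) x =
      d% (fun y ↦ inner ℝ (leviCivita I M Z y (Y y)) (U y)
        + inner ℝ (Z y) (leviCivita I M U y (Y y))) x :=
    mvfderiv_congr heq
  rw [hd, mvfderiv_fun_add (mdifferentiableAt_inner hYZ hU') (mdifferentiableAt_inner hZ' hYU),
    add_apply, leviCivita_metric hX' hYZ hU', leviCivita_metric hX' hZ' hYU]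
  ring

/-- `R(X, Y)` is skew-adjoint. -/
theorem inner_curvature_left {X Y Z U : Π x : M, TangentSpace I x} {x : M}
    (hX : CMDiffAt ∞ (T% X) x) (hY : CMDiffAt ∞ (T% Y) x)
    (hZ : CMDiffAt ∞ (T% Z) x) (hU : CMDiffAt ∞ (T% U) x) :
    inner ℝ (curvature X Y Z x) (U x) = -inner ℝ (Z x) (curvature X Y U x) := by
  have h1 := mvfderiv_mvfderiv_inner hX hY hZ hU
  have h2 := mvfderiv_mvfderiv_inner hY hX hZ hU
  have h3 := mvfderiv_mlieBracket (contMDiffAt_inner hZ hU) hX hY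
  have h4 := leviCivita_metric ((contMDiffAt_mlieBracket hX hY).mdifferentiableAt (by simp))
    (hZ.mdifferentiableAt (by simp)) (hU.mdifferentiableAt (by simp))
  rw [h1, h2, h4] at h3
  simp only [curvature, inner_sub_left, inner_sub_right]
  linarith

/-- The curvature tensor may be computed with any smooth extension of the third argument. -/
theorem curvatureAt_apply_section {Z : Π x : M, TangentSpace I x} {x : M}
    (hZ : CMDiffAt ∞ (T% Z) x) (u v : TangentSpace I x) :
    curvatureAt x u v (Z x) = curvature (extend E u) (extend E v) Z x := by
  have hext (w : TangentSpace I x) : CMDiffAt ∞ (T% (extend E w)) x := contMDiffAt_extend I E w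
  refine ext_inner_right ℝ fun w ↦ ?_
  -- Skew-adjointness moves the third argument out of the derivatives: only its value at x remains.
  have h1 := inner_curvature_left (hext u) (hext v) (hext (Z x)) (hext w)
  have h2 := inner_curvature_left (hext u) (hext v) hZ (hext w)
  simp only [extend_apply_self] at h1 h2
  rw [curvatureAt, h1, h2]

/-- The Lie derivative of the metric in terms of the Levi-Civita connection. -/
theorem lieDerivMetric_eq {V X Y : Π x : M, TangentSpace I x} {x : M} (hV : MDiffAt (T% V) x)
    (hX : MDiffAt (T% X) x) (hY : MDiffAt (T% Y) x) :
    lieDerivMetric V X Y x = inner ℝ (leviCivita I M V x (X x)) (Y x)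
      + inner ℝ (X x) (leviCivita I M V x (Y x)) := by
  rw [lieDerivMetric, leviCivita_metric hV hX hY, ← leviCivita_torsionFree hV hX,
    ← leviCivita_torsionFree hV hY, inner_sub_left, inner_sub_right]
  ring

end LeviCivita

namespace AlmostContactMetric

/-! ### Pointwise algebra of almost contact metric structures -/

section Algebra

variable {E : Type*} [NormedAddCommGroup E] [NormedSpace ℝ E] [FiniteDimensional ℝ E]
  {H : Type*} [TopologicalSpace H] {I : ModelWithCorners ℝ E H}
  {M : Type*} [TopologicalSpace M] [ChartedSpace H M] [IsManifold I ∞ M]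
  [RiemannianBundle (fun x : M ↦ TangentSpace I x)]
  [IsContMDiffRiemannianBundle I ∞ E (fun x : M ↦ TangentSpace I x)]
  (A : AlmostContactMetric I M)

theorem inner_ξ_self (x : M) : inner ℝ (A.ξ x) (A.ξ x) = (1 : ℝ) := by
  rw [← A.η_eq, A.η_ξ]

theorem φ_ξ (x : M) : A.φ x (A.ξ x) = 0 := by
  have h := A.inner_φ_φ x (A.ξ x) (A.ξ x)
  rw [A.η_ξ, A.inner_ξ_self] at h
  exact inner_self_eq_zero.1 (by linarith : inner ℝ (A.φ x (A.ξ x)) (A.φ x (A.ξ x)) = (0 : ℝ))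

theorem η_φ (x : M) (v : TangentSpace I x) : A.η x (A.φ x v) = 0 := by
  have h := A.inner_φ_add x v (A.ξ x)
  rw [A.φ_ξ, inner_zero_right, zero_add] at h
  rw [A.η_eq, real_inner_comm, h]

theorem inner_φ_self (x : M) (v : TangentSpace I x) : inner ℝ (A.φ x v) v = (0 : ℝ) := by
  have h := A.inner_φ_add x v v
  rw [real_inner_comm]
  linarith

theorem inner_φ_left (x : M) (v w : TangentSpace I x) :
    (inner ℝ (A.φ x v) w : ℝ) = -inner ℝ v (A.φ x w) := by
  have h := A.inner_φ_add x v w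
  rw [real_inner_comm]
  linarith

theorem contMDiffAt_ξ (x : M) : CMDiffAt ∞ (T% A.ξ) x := A.smooth_ξ x

theorem contMDiffAt_φ {Y : Π x : M, TangentSpace I x} {x : M} (hY : CMDiffAt ∞ (T% Y) x) :
    CMDiffAt ∞ (T% (fun y ↦ A.φ y (Y y))) x :=
  ContMDiffAt.clm_bundle_apply (A.smooth_φ x) hY

end Algebra

/-! ### Curvature of trans-Sasakian manifolds and the soliton equation -/

section TransSasakian

variable {E : Type*} [NormedAddCommGroup E] [NormedSpace ℝ E] [FiniteDimensional ℝ E]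
  {H : Type*} [TopologicalSpace H] {I : ModelWithCorners ℝ E H}
  {M : Type*} [TopologicalSpace M] [ChartedSpace H M] [IsManifold I ∞ M]
  [RiemannianBundle (fun x : M ↦ TangentSpace I x)]
  [IsContMDiffRiemannianBundle I ∞ E (fun x : M ↦ TangentSpace I x)]
  {A : AlmostContactMetric I M}

/-- Differentiate g(ξ, ξ) = 1. -/
theorem η_leviCivita_ξ (x : M) (v : TangentSpace I x) :
    A.η x (leviCivita I M A.ξ x v) = 0 := by
  have hξ := (A.contMDiffAt_ξ x).mdifferentiableAt (by simp)
  have h := leviCivita_metric (X := extend E v) (mdifferentiableAt_extend ..) hξ hξ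
  simp only [A.inner_ξ_self, mvfderiv_const, extend_apply_self] at h
  change (0 : ℝ) = _ at h
  have hc := real_inner_comm (A.ξ x) (leviCivita I M A.ξ x v)
  rw [A.η_eq]
  linarith

/-- `∇_v ξ = -α φ v + β (v - η(v) ξ)` on a trans-Sasakian manifold. -/
theorem IsTransSasakian.leviCivita_ξ {α β : M → ℝ} (hA : A.IsTransSasakian α β) (x : M)
    (v : TangentSpace I x) :
    leviCivita I M A.ξ x v = -α x • A.φ x v + β x • (v - A.η x v • A.ξ x) := by
  have h := hA.cov_φ x (extend E v) A.ξ (contMDiffAt_extend I E v) (A.contMDiffAt_ξ x)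
  have h0 : (fun y ↦ A.φ y (A.ξ y)) = (0 : Π x : M, TangentSpace I x) := funext A.φ_ξ
  simp only [h0, CovariantDerivative.zero, extend_apply_self, A.η_ξ, one_smul, Pi.zero_apply,
    zero_apply, zero_sub] at h
  rw [← A.η_eq, ← A.η_eq, A.η_φ, zero_smul, zero_sub] at h
  -- At this point `h` gives φ(∇_v ξ). A second φ recovers ∇_v ξ itself, as φ² = -1 on vectors
  -- orthogonal to ξ.
  have h' := congrArg (A.φ x) h
  simp only [map_neg, map_add, map_sub, map_smul, A.φ_φ, A.φ_ξ, A.η_leviCivita_ξ, smul_zero,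
    zero_smul] at h'
  linear_combination (norm := module) (1 : ℝ) • h'

variable [Nontrivial E]

/-- `∇_X ∇_Y ξ` on a trans-Sasakian manifold with constant `α`, `β`. -/
theorem IsTransSasakian.leviCivita_leviCivita_ξ {α β : ℝ}
    (hA : A.IsTransSasakian (fun _ ↦ α) (fun _ ↦ β)) {X Y : Π x : M, TangentSpace I x} {x : M}
    (hX : CMDiffAt ∞ (T% X) x) (hY : CMDiffAt ∞ (T% Y) x) :
    leviCivita I M (fun y ↦ leviCivita I M A.ξ y (Y y)) x (X x) =
      -α • leviCivita I M (fun y ↦ A.φ y (Y y)) x (X x) + β • (leviCivita I M Y x (X x)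
        - ((inner ℝ (leviCivita I M Y x (X x)) (A.ξ x)
          + inner ℝ (Y x) (leviCivita I M A.ξ x (X x)) : ℝ) • A.ξ x
          + A.η x (Y x) • leviCivita I M A.ξ x (X x))) := by
  have hξ := A.contMDiffAt_ξ x
  have hX' := hX.mdifferentiableAt (by simp)
  have hY' := hY.mdifferentiableAt (by simp)
  have hξ' := hξ.mdifferentiableAt (by simp)
  have hφ := (A.contMDiffAt_φ hY).mdifferentiableAt (by simp)
  have hη := mdifferentiableAt_inner hY' hξ'
  have hηξ := hη.smul_section hξ'
  have hc := (leviCivita I M).isCovariantDerivativeOnUniv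
  -- Writing η(Y) as g(Y, ξ) lets metric compatibility compute its derivative in the Leibniz rule.
  have heq : (fun y ↦ leviCivita I M A.ξ y (Y y)) = (-α) • (fun y ↦ A.φ y (Y y))
      + (β • Y + (-β) • ((fun y ↦ inner ℝ (Y y) (A.ξ y)) • A.ξ)) := by
    funext y
    simp only [hA.leviCivita_ξ, A.η_eq, Pi.add_apply, Pi.smul_apply, Pi.smul_apply']
    module
  have h1 := MDifferentiableAt.smul_const_section (a := -α) hφ
  have h2 := MDifferentiableAt.smul_const_section (a := β) hY'
  have h3 := MDifferentiableAt.smul_const_section (a := -β) hηξ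
  rw [heq, hc.add h1 (mdifferentiableAt_add_section h2 h3), hc.add h2 h3,
    hc.smul_const _ hφ, hc.smul_const _ hY', hc.smul_const _ hηξ, hc.leibniz hξ' hη, A.η_eq]
  have hm := leviCivita_metric hX' hY' hξ'
  simp only [add_apply, smul_apply, ContinuousLinearMap.smulRight_apply, hm]
  module

/-- `R(X, Y)ξ = (α² - β²)(η(Y) X - η(X) Y) + 2αβ (η(Y) φX - η(X) φY)`. -/
theorem IsTransSasakian.curvature_ξ {α β : ℝ}
    (hA : A.IsTransSasakian (fun _ ↦ α) (fun _ ↦ β)) {X Y : Π x : M, TangentSpace I x} {x : M}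
    (hX : CMDiffAt ∞ (T% X) x) (hY : CMDiffAt ∞ (T% Y) x) :
    curvature X Y A.ξ x = (α ^ 2 - β ^ 2) • (A.η x (Y x) • X x - A.η x (X x) • Y x)
      + (2 * α * β) • (A.η x (Y x) • A.φ x (X x) - A.η x (X x) • A.φ x (Y x)) := by
  -- These turn ∇_X(φY) into φ(∇_X Y) plus algebraic terms; the derivatives of X and Y then cancel
  -- against ∇_[X,Y] ξ, because the torsion vanishes.
  have h1 := hA.cov_φ x X Y hX hY
  have h2 := hA.cov_φ x Y X hY hX
  rw [sub_eq_iff_eq_add] at h1 h2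
  rw [curvature, hA.leviCivita_leviCivita_ξ hX hY, hA.leviCivita_leviCivita_ξ hY hX, h1, h2,
    ← leviCivita_torsionFree (hX.mdifferentiableAt (by simp)) (hY.mdifferentiableAt (by simp))]
  simp only [hA.leviCivita_ξ, map_sub, A.η_eq, inner_add_right, inner_smul_right, inner_sub_left,
    inner_sub_right, A.inner_φ_left, real_inner_comm (X x) (Y x)]
  have hs := A.inner_φ_add x (X x) (Y x)
  rw [eq_neg_of_add_eq_zero_left hs]
  module

theorem IsTransSasakian.curvatureAt_ξ {α β : ℝ}
    (hA : A.IsTransSasakian (fun _ ↦ α) (fun _ ↦ β)) (x : M) (u v : TangentSpace I x) :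
    curvatureAt x u v (A.ξ x) = (α ^ 2 - β ^ 2) • (A.η x v • u - A.η x u • v)
      + (2 * α * β) • (A.η x v • A.φ x u - A.η x u • A.φ x v) := by
  rw [curvatureAt_apply_section (A.contMDiffAt_ξ x),
    hA.curvature_ξ (contMDiffAt_extend I E u) (contMDiffAt_extend I E v)]
  simp only [extend_apply_self]

/-- Parseval's identity for the unit vector ξ. -/
theorem sum_sq_η (A : AlmostContactMetric I M) {ι : Type*} [Fintype ι] (x : M)
    (e : OrthonormalBasis ι ℝ (TangentSpace I x)) :
    ∑ i, A.η x (e i) * A.η x (e i) = 1 := by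
  simp only [A.η_eq]
  rw [← A.inner_ξ_self x, ← e.sum_inner_mul_inner]
  exact Finset.sum_congr rfl fun i _ ↦ by rw [real_inner_comm (e i)]

/-- `S(ξ, ξ) = (dim M - 1)(α² - β²)`. -/
theorem IsTransSasakian.ricci_ξ_ξ {α β : ℝ} (hA : A.IsTransSasakian (fun _ ↦ α) (fun _ ↦ β))
    (x : M) :
    ricci x (A.ξ x) (A.ξ x) = (Module.finrank ℝ E - 1) * (α ^ 2 - β ^ 2) := by
  set e := stdOrthonormalBasis ℝ (TangentSpace I x) with he
  have hs := A.sum_sq_η x e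
  -- The 2αβ part contributes nothing, since φξ = 0 and g(φu, u) = 0.
  have key (i) : inner ℝ (curvatureAt x (e i) (A.ξ x) (A.ξ x)) (e i) =
      (α ^ 2 - β ^ 2) * (1 - A.η x (e i) * A.η x (e i)) := by
    rw [hA.curvatureAt_ξ, A.η_ξ, A.φ_ξ, smul_zero, sub_zero, one_smul, one_smul, inner_add_left,
      real_inner_smul_left, real_inner_smul_left, A.inner_φ_self, inner_sub_left,
      real_inner_smul_left, real_inner_comm, real_inner_self_eq_norm_sq, e.norm_eq_one,
      real_inner_comm, ← A.η_eq]
    ring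
  have hcard : Module.finrank ℝ (TangentSpace I x) = Module.finrank ℝ E := rfl
  simp only [ricci, ← he, key, ← Finset.mul_sum, Finset.sum_sub_distrib, hs]
  simp [hcard]
  ring

/-- The Ricci tensor of a trans-Sasakian `η`-Einstein soliton. -/
theorem EtaEinsteinSoliton.ricci_eq {α β : M → ℝ} (hA : A.IsTransSasakian α β)
    (s : A.EtaEinsteinSoliton) (x : M) (v w : TangentSpace I x) :
    ricci x v w = (scalarCurvature I x / 2 - s.lam - β x) * inner ℝ v w
      + (β x - s.mu) * (A.η x v * A.η x w) := by
  have hv := contMDiffAt_extend (k := ∞) I E v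
  have hw := contMDiffAt_extend (k := ∞) I E w
  have h := s.eq_zero x (extend E v) (extend E w) hv hw
  rw [lieDerivMetric_eq ((A.contMDiffAt_ξ x).mdifferentiableAt (by simp))
    (hv.mdifferentiableAt (by simp)) (hw.mdifferentiableAt (by simp))] at h
  -- The α-terms of L_ξ g cancel by skewness of φ, leaving 2β (g - η⊗η).
  simp only [extend_apply_self, hA.leviCivita_ξ, inner_add_left, inner_add_right,
    real_inner_smul_left, inner_smul_right, inner_sub_left, inner_sub_right, A.inner_φ_left,
    real_inner_comm w (A.ξ x), ← A.η_eq] at h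
  linarith

/-- Trace of `ricci_eq`, with tr g = dim M and tr(η⊗η) = 1; r occurs on both sides. -/
theorem EtaEinsteinSoliton.two_sub_finrank_mul_scalarCurvature {α β : M → ℝ}
    (hA : A.IsTransSasakian α β) (s : A.EtaEinsteinSoliton) (x : M) :
    (2 - Module.finrank ℝ E) * scalarCurvature I x =
      -2 * Module.finrank ℝ E * (s.lam + β x) + 2 * (β x - s.mu) := by
  set e := stdOrthonormalBasis ℝ (TangentSpace I x) with he
  have hs := A.sum_sq_η x e
  have hcard : Module.finrank ℝ (TangentSpace I x) = Module.finrank ℝ E := rfl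
  have h : scalarCurvature I x = ∑ i, ricci x (e i) (e i) := rfl
  simp only [s.ricci_eq hA, Finset.sum_add_distrib, ← Finset.mul_sum, hs] at h
  simp [hcard] at h
  linarith

end TransSasakian

end AlmostContactMetric

end TransSasakian

/-! ### The theorem in dimension three -/

theorem theorem3p1 {M : Type*} [TopologicalSpace M] [T2Space M] [SecondCountableTopology M]
    [Nonempty M] [ChartedSpace (EuclideanSpace ℝ (Fin 3)) M] [IsManifold (𝓡 3) ∞ M]
    [RiemannianBundle (fun x : M ↦ TangentSpace (𝓡 3) x)]
    [IsContMDiffRiemannianBundle (𝓡 3) ∞ (EuclideanSpace ℝ (Fin 3))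
      (fun x : M ↦ TangentSpace (𝓡 3) x)]
    (A : TransSasakian.AlmostContactMetric (𝓡 3) M) (α β : ℝ)
    (hA : A.IsTransSasakian (fun _ ↦ α) (fun _ ↦ β)) (s : A.EtaEinsteinSoliton) :
    A.IsEtaEinstein ∧
    (∀ x : M, TransSasakian.scalarCurvature (𝓡 3) x = 6 * s.lam + 4 * β + 2 * s.mu) ∧
    s.lam = (α ^ 2 - β ^ 2) - β ∧
    (s.IsShrinking ↔ α ^ 2 < β * (β + 1)) ∧
    (s.IsSteady ↔ α ^ 2 = β * (β + 1)) ∧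
    (s.IsExpanding ↔ α ^ 2 > β * (β + 1)) := by
  have hr (x : M) : TransSasakian.scalarCurvature (𝓡 3) x = 6 * s.lam + 4 * β + 2 * s.mu := by
    have h := s.two_sub_finrank_mul_scalarCurvature hA x
    simp only [finrank_euclideanSpace_fin, Nat.cast_ofNat] at h
    linarith
  have hlam : s.lam = (α ^ 2 - β ^ 2) - β := by
    obtain ⟨x⟩ := ‹Nonempty M›
    -- Two values of S(ξ, ξ) are equated: 2(α² - β²) from the curvature and 2λ + 2β from the
    -- soliton.
    have h := s.ricci_eq hA x (A.ξ x) (A.ξ x)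
    rw [hA.ricci_ξ_ξ, hr, A.inner_ξ_self, A.η_ξ] at h
    simp only [finrank_euclideanSpace_fin, Nat.cast_ofNat] at h
    linarith
  refine ⟨⟨fun _ ↦ (6 * s.lam + 4 * β + 2 * s.mu) / 2 - s.lam - β, fun _ ↦ β - s.mu,
    contMDiff_const, contMDiff_const, fun x v w ↦ ?_⟩, hr, hlam, ?_, ?_, ?_⟩
  · rw [s.ricci_eq hA, hr]
  · rw [TransSasakian.AlmostContactMetric.EtaEinsteinSoliton.IsShrinking, hlam]
    constructor <;> intro h <;> linarith
  · rw [TransSasakian.AlmostContactMetric.EtaEinsteinSoliton.IsSteady, hlam]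
    constructor <;> intro h <;> linarith
  · rw [TransSasakian.AlmostContactMetric.EtaEinsteinSoliton.IsExpanding, hlam]
    constructor <;> intro h <;> linarith
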